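/- Let $\nu>0$ be real and let $m\ge 0$ be an integer. For real $\lambda$ and $x>0$ let $$J_\lambda(x)=\sum_{k\ge 0}\frac{(-1)^k}{k!\,\Gamma(\lambda+k+1)}\Big(\frac x2\Big)^{2k+\lambda}$$ be the Bessel function of the first kind. For integers $n\ge 0$ let $$R_{n,\lambda}(x)=\sum_{k=0}^{\lfloor n/2\rfloor}(-1)^k\binom{n-k}{k}\frac{\Gamma(\lambda+n-k)}{\Gamma(\lambda+k)}\Big(\frac x2\Big)^{2k-n}$$ be the Lommel polynomial (a polynomial in $1/x$; at poles of $\Gamma$ the quotient is understood as the rising factorial $(\lambda+k)_{n-2k}$), extended to negative indices by $R_{-n,\lambda}=-R_{n-2,\lambda-n+1}$ (so $R_{-1,\lambda}=0$), and put $$R^*_{m,\nu}=\tfrac12\big(R_{m,\nu}-R_{m-2,\nu+2}\big).$$ Then the positive zeros of $J_\nu'$ that are not zeros of $J_{\nu+m}$ form an infinite sequence $a_1<a_2<\cdots$ in ascending order; the union of the set of positive zeros of $J_{\nu+m}$ and the set of positive zeros of $R^*_{m,\nu}$ forms an infinite sequence $\omega_1<\omega_2<\cdots$ in ascending order (each point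 being listed once); and these two sequences interlace: $$0<a_1<\omega_1<a_2<\omega_2<\cdots .$$ -/

import Mathlib

/-- The Bessel function of the first kind of real order `ν`, as a function of a real variable `x`,
given by its power series. It is meant for `x > 0`. -/
noncomputable def besselJ (ν x : ℝ) : ℝ :=
  ∑' k : ℕ, (-1 : ℝ) ^ k / ((k.factorial : ℝ) * Real.Gamma (ν + k + 1)) * (x / 2) ^ (2 * (k : ℝ) + ν)

/-- The Lommel polynomial `R_{n,ν}` of index `n ≥ 0` (a polynomial in `1/x`). The coefficient
`Γ(ν + n - k) / Γ(ν + k)` is written as the rising factorial `(ν + k)_{n - 2k}`, which is its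
value, with the removable singularities at the poles of `Γ` removed
(see `lommelNat_eq_sum_Gamma`). -/
noncomputable def lommelNat (n : ℕ) (ν x : ℝ) : ℝ :=
  ∑ k ∈ Finset.range (n / 2 + 1),
    (-1 : ℝ) ^ k * ((n - k).choose k : ℝ) * (ascPochhammer ℝ (n - 2 * k)).eval (ν + k)
      * (x / 2) ^ (2 * (k : ℤ) - (n : ℤ))

/-- The Lommel polynomial `R_{m,ν}` for every integer `m`, extended to negative indices by
`R_{-m,ν} = - R_{m-2,ν-m+1}`; in particular `R_{-1,ν} = 0`. -/
noncomputable def lommelR : ℤ → ℝ → ℝ → ℝ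
  | Int.ofNat n, ν, x => lommelNat n ν x
  | Int.negSucc 0, _, _ => 0
  | Int.negSucc (n + 1), ν, x => -lommelNat n (ν - n - 1) x

/-- The associated polynomial `R*_{m,ν} = (R_{m,ν} - R_{m-2,ν+2}) / 2`. -/
noncomputable def lommelRStar (m : ℤ) (ν x : ℝ) : ℝ :=
  (lommelR m ν x - lommelR (m - 2) (ν + 2) x) / 2

/-- The set of positive zeros of a function on the real line. -/
def posZeros (f : ℝ → ℝ) : Set ℝ := {x | 0 < x ∧ f x = 0}

/-- `a` lists all the elements of `S`, an infinite set, each exactly once and in ascending order. -/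
def IsAscendingEnum (a : ℕ → ℝ) (S : Set ℝ) : Prop := StrictMono a ∧ Set.range a = S

/-- The rising factorial as a quotient of Gamma values. -/
theorem ascPochhammer_eval_eq_Gamma_div {s : ℝ} (hs : ∀ n : ℕ, s ≠ -n) (n : ℕ) :
    (ascPochhammer ℝ n).eval s = Real.Gamma (s + n) / Real.Gamma s := by
  have h0 : Real.Gamma s ≠ 0 := Real.Gamma_ne_zero hs
  induction n with
  | zero => simp [h0]
  | succ n ih =>
    have h1 : s + n ≠ 0 := fun h => hs n (by linarith)
    rw [ascPochhammer_succ_eval, ih, Nat.cast_succ, ← add_assoc, Real.Gamma_add_one h1]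
    ring

/-- The classical explicit formula for the Lommel polynomial, away from the poles of `Γ`. -/
theorem lommelNat_eq_sum_Gamma (n : ℕ) {ν : ℝ} (hν : ∀ k : ℕ, ν ≠ -k) (x : ℝ) :
    lommelNat n ν x = ∑ k ∈ Finset.range (n / 2 + 1),
      (-1 : ℝ) ^ k * ((n - k).choose k : ℝ) * (Real.Gamma (ν + n - k) / Real.Gamma (ν + k))
        * (x / 2) ^ (2 * (k : ℤ) - (n : ℤ)) := by
  unfold lommelNat
  refine Finset.sum_congr rfl fun k hk => ?_
  have hk' : 2 * k ≤ n := by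
    have := Finset.mem_range.1 hk
    omega
  rw [ascPochhammer_eval_eq_Gamma_div (fun j h => hν (k + j) (by push_cast; linarith)),
    Nat.cast_sub hk']
  congr 4
  push_cast
  ring

/-! Write `l = ν + m`. Contiguity gives `J_ν' = R*_{m+1} J_l - R*_m J_{l+1}`; dividing by `R*_m J_l`
gives `F = R*_{m+1}/R*_m - J_{l+1}/J_l`, whose poles are the `ω_k`. Both summands have negative
Wronskian (`lommelRStar_wronskian_neg`, `besselJ_wronskian_pos`), so `F` decreases strictly between
consecutive poles, from `+∞` to `-∞`. The poles of the two summands reinforce each other even where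
they coincide.

Near `0`, `F > 0`, so each gap, including the one from `0` to `ω_1`, holds exactly one zero of `F`
(`exists_interlacing_zeros`). The poles are infinite in number because `J_l` oscillates
(`exists_besselJ_zero_gt`). Finally, the zeros of `F` are the zeros of `J_ν'` outside those of
`J_l`: at a zero of `R*_m` the Wronskian forces `R*_{m+1} ≠ 0`, so `J_ν'` can vanish there only
together with `J_l`. -/

open Filter Topology Set

/-! ### Power series, derivatives and recurrences of Bessel functions -/

/-- The coefficients of the entire function underlying `besselJ`. -/
noncomputable def besselCoeff (l : ℝ) (k : ℕ) : ℝ :=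
  (-1 : ℝ) ^ k / ((k.factorial : ℝ) * Real.Gamma (l + k + 1))

/-- The entire function `E` with `J_l(x) = (x/2)^l E(x²/4)`. -/
noncomputable def besselE (l t : ℝ) : ℝ := ∑' k : ℕ, besselCoeff l k * t ^ k

theorem Gamma_le_Gamma_add_nat {l : ℝ} (hl : 0 < l) (k : ℕ) :
    Real.Gamma (l + 1) ≤ Real.Gamma (l + k + 1) := by
  induction k with
  | zero => simp
  | succ k ih =>
    have hp : 0 < l + k + 1 := by positivity
    have h : Real.Gamma (l + (k + 1 : ℕ) + 1) = (l + k + 1) * Real.Gamma (l + k + 1) := by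
      rw [← Real.Gamma_add_one hp.ne']
      push_cast
      ring_nf
    rw [h]
    have h1 := Real.Gamma_pos_of_pos hp
    have h2 : (0 : ℝ) ≤ k := k.cast_nonneg
    nlinarith

theorem abs_besselCoeff_le {l : ℝ} (hl : 0 < l) (k : ℕ) :
    |besselCoeff l k| ≤ (Real.Gamma (l + 1))⁻¹ / k.factorial := by
  have h0 : 0 < Real.Gamma (l + 1) := Real.Gamma_pos_of_pos (by linarith)
  have h1 := Gamma_le_Gamma_add_nat hl k
  have h2 : (0 : ℝ) < k.factorial := by positivity
  rw [besselCoeff, abs_div, abs_pow, abs_neg, abs_one, one_pow, abs_of_pos (by positivity),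
    inv_eq_one_div, div_div]
  rw [mul_comm]
  gcongr

theorem summable_besselE {l : ℝ} (hl : 0 < l) (t : ℝ) :
    Summable fun k : ℕ => besselCoeff l k * t ^ k := by
  refine Summable.of_norm_bounded
    (g := fun k : ℕ => (Real.Gamma (l + 1))⁻¹ * (|t| ^ k / k.factorial))
    ((Real.summable_pow_div_factorial |t|).mul_left _) fun k => ?_
  rw [Real.norm_eq_abs, abs_mul, abs_pow]
  calc _ ≤ (Real.Gamma (l + 1))⁻¹ / k.factorial * |t| ^ k := by
        gcongr
        exact abs_besselCoeff_le hl k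
    _ = _ := by ring

theorem besselCoeff_succ (l : ℝ) (k : ℕ) :
    besselCoeff l (k + 1) * (k + 1) = -besselCoeff (l + 1) k := by
  have h : (k.factorial : ℝ) ≠ 0 := by positivity
  have h' : (k : ℝ) + 1 ≠ 0 := by positivity
  have e : l + ((k + 1 : ℕ) : ℝ) + 1 = l + 1 + k + 1 := by push_cast; ring
  rw [besselCoeff, besselCoeff, e, Nat.factorial_succ, pow_succ]
  push_cast
  -- At a pole `Real.Gamma` is `0`, and both sides vanish through division by zero.
  by_cases hG : Real.Gamma (l + 1 + k + 1) = 0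
  · simp [hG]
  · field_simp

theorem hasDerivAt_besselE {l : ℝ} (hl : 0 < l) (t : ℝ) :
    HasDerivAt (besselE l) (-besselE (l + 1) t) t := by
  set R := |t| + 1
  have hsum : Summable fun k : ℕ =>
      (Real.Gamma (l + 1 + 1))⁻¹ * (R ^ (k - 1) / (k - 1).factorial) := by
    refine Summable.mul_left _ ?_
    rw [← summable_nat_add_iff 1]
    simpa using Real.summable_pow_div_factorial R
  have key := hasDerivAt_tsum_of_isPreconnected (t := Metric.ball (0 : ℝ) R) (y₀ := t) (y := t)
    (g := fun k y => besselCoeff l k * y ^ k)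
    (g' := fun k y => besselCoeff l k * (k * y ^ (k - 1))) hsum Metric.isOpen_ball
    (convex_ball 0 R).isPreconnected
    (fun k y _ => (hasDerivAt_pow k y).const_mul _) ?_ (by simp [R]) (summable_besselE hl t)
    (by simp [R])
  · refine HasDerivAt.congr_deriv (f := besselE l) key ?_
    rw [Summable.tsum_eq_zero_add, besselE, ← tsum_neg]
    · simp only [CharP.cast_eq_zero, zero_mul, mul_zero, zero_add]
      refine tsum_congr fun k => ?_
      rw [← neg_mul, ← besselCoeff_succ]
      push_cast
      ring
    · rw [← summable_nat_add_iff 1]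
      refine (summable_besselE (l := l + 1) (by linarith) t).neg.congr fun k => ?_
      rw [← neg_mul, ← besselCoeff_succ]
      push_cast
      ring
  · intro k y hy
    have hG : 0 < Real.Gamma (l + 1 + 1) := Real.Gamma_pos_of_pos (by linarith)
    have hR : 0 ≤ R := by positivity
    rcases k with _ | k
    · simpa using hG.le
    have hy' : |y| ≤ R := by simpa using (mem_ball_zero_iff.1 hy).le
    have e : besselCoeff l (k + 1) * (((k + 1 : ℕ) : ℝ) * y ^ (k + 1 - 1))
        = -besselCoeff (l + 1) k * y ^ k := by
      rw [← besselCoeff_succ]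
      push_cast
      ring
    rw [e, Real.norm_eq_abs, abs_mul, abs_neg, abs_pow, Nat.add_sub_cancel]
    calc _ ≤ (Real.Gamma (l + 1 + 1))⁻¹ / k.factorial * R ^ k := by
          gcongr
          exact abs_besselCoeff_le (by linarith) k
      _ = _ := by ring

/-- Coefficientwise, `(l + 1) c_{l+1}(k) = c_l(k) - k c_{l+1}(k)`, and `-k c_{l+1}(k)` is `c_{l+2}(k
- 1)`. -/
theorem besselE_recurrence {l : ℝ} (hl : 0 < l) (t : ℝ) :
    besselE l t + t * besselE (l + 2) t = (l + 1) * besselE (l + 1) t := by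
  have h0 := summable_besselE hl t
  have h1 := summable_besselE (l := l + 1) (by linarith) t
  have h2 := summable_besselE (l := l + 2) (by linarith) t
  have hG : ∀ s : ℝ, 0 < s → Real.Gamma s ≠ 0 := fun s hs => (Real.Gamma_pos_of_pos hs).ne'
  have hc : ∀ k : ℕ, (l + k + 1) * besselCoeff (l + 1) k = besselCoeff l k := by
    intro k
    have hp : 0 < l + k + 1 := by positivity
    have := hG _ hp
    rw [besselCoeff, besselCoeff, show l + 1 + k + 1 = l + k + 1 + 1 by ring,
      Real.Gamma_add_one hp.ne']
    field_simp
  unfold besselE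
  rw [h0.tsum_eq_zero_add, h1.tsum_eq_zero_add, mul_add, ← tsum_mul_left, ← tsum_mul_left, add_assoc,
    ← Summable.tsum_add ((summable_nat_add_iff 1).2 h0) (h2.mul_left t)]
  congr 1
  · rw [← hc 0]
    simp
  · refine tsum_congr fun k => ?_
    have a1 := hc (k + 1)
    have a2 := besselCoeff_succ (l + 1) k
    rw [show l + 1 + 1 = l + 2 by ring] at a2
    push_cast at a1
    rw [← a1, show besselCoeff (l + 2) k = -(besselCoeff (l + 1) (k + 1) * (k + 1)) by linarith]
    ring

theorem besselJ_eq_rpow_mul (l : ℝ) {x : ℝ} (hx : 0 < x) :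
    besselJ l x = (x / 2) ^ l * besselE l ((x / 2) ^ 2) := by
  have h : 0 < x / 2 := by positivity
  rw [besselJ, besselE, ← tsum_mul_left]
  refine tsum_congr fun k => ?_
  rw [Real.rpow_add h, ← pow_mul, besselCoeff]
  have : (x / 2) ^ (2 * (k : ℝ)) = (x / 2) ^ (2 * k) := by
    rw [← Real.rpow_natCast]
    push_cast
    rfl
  rw [this]
  ring

theorem hasDerivAt_besselJ {l : ℝ} (hl : 0 < l) {x : ℝ} (hx : 0 < x) :
    HasDerivAt (besselJ l) (l / x * besselJ l x - besselJ (l + 1) x) x := by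
  have h : 0 < x / 2 := by positivity
  have hd : HasDerivAt (fun y : ℝ => y / 2) (1 / 2) x := (hasDerivAt_id x).div_const 2
  have h1 := (hd.rpow_const (p := l) (Or.inl h.ne')).mul
    ((hasDerivAt_besselE hl ((x / 2) ^ 2)).comp x (hd.pow 2))
  have h2 := h1.congr_of_eventuallyEq (f₁ := besselJ l) (by
    filter_upwards [lt_mem_nhds hx] with y hy
    rw [besselJ_eq_rpow_mul l hy]
    rfl)
  refine h2.congr_deriv ?_
  rw [besselJ_eq_rpow_mul l hx, besselJ_eq_rpow_mul _ hx, Real.rpow_add h, Real.rpow_sub h,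
    Real.rpow_one]
  simp only [Function.comp, Pi.pow_apply]
  generalize besselE l ((x / 2) ^ 2) = e
  generalize besselE (l + 1) ((x / 2) ^ 2) = e'
  field_simp
  push_cast
  ring

theorem besselJ_recurrence {l : ℝ} (hl : 0 < l) {x : ℝ} (hx : 0 < x) :
    besselJ (l + 2) x = 2 * (l + 1) / x * besselJ (l + 1) x - besselJ l x := by
  have h : 0 < x / 2 := by positivity
  have := besselE_recurrence hl ((x / 2) ^ 2)
  rw [besselJ_eq_rpow_mul l hx, besselJ_eq_rpow_mul _ hx, besselJ_eq_rpow_mul _ hx,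
    Real.rpow_add h, Real.rpow_add h, Real.rpow_one, Real.rpow_two]
  rw [show besselE l ((x / 2) ^ 2) = (l + 1) * besselE (l + 1) ((x / 2) ^ 2)
    - (x / 2) ^ 2 * besselE (l + 2) ((x / 2) ^ 2) by linarith]
  field_simp
  ring

/-- With `J_{l+2}` eliminated, `(J_l, J_{l+1})` solves a closed first-order linear system. -/
theorem hasDerivAt_besselJ_add_one {l : ℝ} (hl : 0 < l) {x : ℝ} (hx : 0 < x) :
    HasDerivAt (besselJ (l + 1)) (besselJ l x - (l + 1) / x * besselJ (l + 1) x) x := by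
  refine (hasDerivAt_besselJ (l := l + 1) (by linarith) hx).congr_deriv ?_
  rw [show l + 1 + 1 = l + 2 by ring, besselJ_recurrence hl hx]
  ring

/-! ### Behaviour at the origin -/

theorem besselE_zero_pos {l : ℝ} (hl : 0 < l) : 0 < besselE l 0 := by
  have : besselE l 0 = besselCoeff l 0 := by
    rw [besselE, tsum_eq_single 0 (fun k hk => by simp [hk])]
    simp
  rw [this, besselCoeff]
  have : 0 < Real.Gamma (l + 1) := Real.Gamma_pos_of_pos (by linarith)
  simpa using this

theorem tendsto_besselE_half_sq {l : ℝ} (hl : 0 < l) :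
    Tendsto (fun x : ℝ => besselE l ((x / 2) ^ 2)) (𝓝[>] 0) (𝓝 (besselE l 0)) := by
  have h : Tendsto (fun x : ℝ => (x / 2) ^ 2) (𝓝[>] 0) (𝓝 0) := by
    have : ContinuousAt (fun x : ℝ => (x / 2) ^ 2) 0 := by fun_prop
    simpa [ContinuousAt] using this.tendsto.mono_left (nhdsWithin_le_nhds (s := Ioi 0))
  exact (hasDerivAt_besselE hl 0).continuousAt.tendsto.comp h

theorem eventually_besselJ_pos {l : ℝ} (hl : 0 < l) : ∀ᶠ x in 𝓝[>] (0 : ℝ), 0 < besselJ l x := by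
  filter_upwards [(tendsto_besselE_half_sq hl).eventually (lt_mem_nhds (besselE_zero_pos hl)),
    self_mem_nhdsWithin] with x hx hx0
  have hx0 : 0 < x := hx0
  rw [besselJ_eq_rpow_mul l hx0]
  positivity

theorem tendsto_besselJ_zero {l : ℝ} (hl : 0 < l) :
    Tendsto (besselJ l) (𝓝[>] 0) (𝓝 0) := by
  have h1 : Tendsto (fun x : ℝ => (x / 2) ^ l) (𝓝[>] 0) (𝓝 0) := by
    have : ContinuousAt (fun x : ℝ => (x / 2) ^ l) 0 :=
      ContinuousAt.rpow_const (by fun_prop) (Or.inr hl.le)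
    simpa [ContinuousAt, Real.zero_rpow hl.ne'] using
      this.tendsto.mono_left (nhdsWithin_le_nhds (s := Ioi 0))
  have h2 := h1.mul (tendsto_besselE_half_sq hl)
  rw [zero_mul] at h2
  refine h2.congr' ?_
  filter_upwards [self_mem_nhdsWithin] with x hx
  rw [besselJ_eq_rpow_mul l hx]

/-- Near the origin `J_{l+1} < J_l`. -/
theorem eventually_besselJ_add_one_lt {l : ℝ} (hl : 0 < l) :
    ∀ᶠ x in 𝓝[>] (0 : ℝ), besselJ (l + 1) x < besselJ l x := by
  have h1 : Tendsto (fun x : ℝ => x / 2 * besselE (l + 1) ((x / 2) ^ 2)) (𝓝[>] 0) (𝓝 0) := by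
    have : Tendsto (fun x : ℝ => x / 2) (𝓝[>] 0) (𝓝 0) := by
      have : ContinuousAt (fun x : ℝ => x / 2) 0 := by fun_prop
      simpa [ContinuousAt] using this.tendsto.mono_left (nhdsWithin_le_nhds (s := Ioi 0))
    simpa using this.mul (tendsto_besselE_half_sq (l := l + 1) (by linarith))
  filter_upwards [h1.eventually_lt (tendsto_besselE_half_sq hl) (besselE_zero_pos hl),
    self_mem_nhdsWithin] with x hx hx0
  have hx0 : 0 < x := hx0
  have h : 0 < x / 2 := by positivity
  rw [besselJ_eq_rpow_mul l hx0, besselJ_eq_rpow_mul _ hx0, Real.rpow_add h, Real.rpow_one, mul_assoc]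
  gcongr

/-! ### Turán inequality and the Bessel Wronskian -/

/-- The Turán-type inequality `x² (J_{l+1}² - J_l J_{l+2}) > 0`, with `J_{l+2}` eliminated by the
three-term recurrence. -/
theorem besselJ_turan {l : ℝ} (hl : 0 < l) {x : ℝ} (hx : 0 < x) :
    0 < x ^ 2 * besselJ l x ^ 2 + x ^ 2 * besselJ (l + 1) x ^ 2
      - 2 * (l + 1) * x * besselJ l x * besselJ (l + 1) x := by
  set T : ℝ → ℝ := fun x => x ^ 2 * besselJ l x ^ 2 + x ^ 2 * besselJ (l + 1) x ^ 2
      - 2 * (l + 1) * x * besselJ l x * besselJ (l + 1) x with hT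
  have hl1 : 0 < l + 1 := by linarith
  have hd : ∀ y, 0 < y → HasDerivAt T (2 * y * besselJ (l + 1) y ^ 2) y := by
    intro y hy
    have hu := hasDerivAt_besselJ hl hy
    have hv := hasDerivAt_besselJ_add_one hl hy
    have hs := hasDerivAt_pow 2 y
    have h := ((hs.mul (hu.pow 2)).add (hs.mul (hv.pow 2))).sub
      ((((hasDerivAt_id y).const_mul (2 * (l + 1))).mul hu).mul hv)
    refine h.congr_deriv ?_
    simp only [Pi.mul_apply, Pi.pow_apply, id]
    field_simp
    ring
  have hmono : MonotoneOn T (Ioi 0) := by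
    refine monotoneOn_of_deriv_nonneg (convex_Ioi 0)
      (fun y hy => (hd y hy).continuousAt.continuousWithinAt)
      (fun y hy => (hd y (by simpa using hy)).differentiableAt.differentiableWithinAt) ?_
    intro y hy
    have hy : 0 < y := by simpa using hy
    rw [(hd y hy).deriv]
    positivity
  have hlim : Tendsto T (𝓝[>] 0) (𝓝 0) := by
    have hx : Tendsto (fun x : ℝ => x) (𝓝[>] 0) (𝓝 0) := nhdsWithin_le_nhds
    have hu := tendsto_besselJ_zero hl
    have hv := tendsto_besselJ_zero hl1
    have := (((hx.pow 2).mul (hu.pow 2)).add ((hx.pow 2).mul (hv.pow 2))).sub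
      (((hx.const_mul (2 * (l + 1))).mul hu).mul hv)
    simpa using this
  have hnn : ∀ y, 0 < y → 0 ≤ T y := by
    intro y hy
    refine le_of_tendsto hlim ?_
    filter_upwards [Ioo_mem_nhdsGT hy] with z hz
    exact hmono hz.1 hy hz.2.le
  -- Strictness: `T x = 0` would make `T` vanish on `(0, x)`, hence also `T' = 2 y J_{l+1}²`, but
  -- `J_{l+1} > 0` near `0`.
  refine lt_of_le_of_ne (hnn x hx) fun h0 => ?_
  obtain ⟨y, hy, hyx⟩ := ((eventually_besselJ_pos hl1).and (Ioo_mem_nhdsGT hx)).exists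
  have hconst : T =ᶠ[𝓝 y] fun _ => 0 := by
    filter_upwards [Ioo_mem_nhds hyx.1 hyx.2] with z hz
    exact le_antisymm ((hmono hz.1 hx hz.2.le).trans h0.symm.le) (hnn z hz.1)
  have := (hd y hyx.1).unique ((hasDerivAt_const y (0 : ℝ)).congr_of_eventuallyEq hconst)
  have : 0 < 2 * y * besselJ (l + 1) y ^ 2 := by
    have := hyx.1
    positivity
  linarith

/-- `J_{l+1} / J_l` is increasing: its Wronskian is positive. -/
theorem besselJ_wronskian_pos {l : ℝ} (hl : 0 < l) {x : ℝ} (hx : 0 < x) :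
    0 < (besselJ l x - (l + 1) / x * besselJ (l + 1) x) * besselJ l x
      - besselJ (l + 1) x * (l / x * besselJ l x - besselJ (l + 1) x) := by
  have hT := besselJ_turan hl hx
  set u := besselJ l x
  set v := besselJ (l + 1) x
  have e : (u - (l + 1) / x * v) * u - v * (l / x * u - v)
      = (x ^ 2 * u ^ 2 + x ^ 2 * v ^ 2 - (2 * l + 1) * x * (u * v)) / x ^ 2 := by
    field_simp
    ring
  rw [e]
  refine div_pos ?_ (by positivity)
  -- The numerator is the Turán expression plus `x u v`; if `u v < 0`, its cross term is positive by
  -- itself.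
  rcases le_or_gt 0 (u * v) with h | h
  · have : 0 ≤ x * (u * v) := by positivity
    nlinarith
  · have h1 : 0 < (2 * l + 1) * x * -(u * v) := by
      have : 0 < -(u * v) := by linarith
      positivity
    have : 0 ≤ x ^ 2 * u ^ 2 + x ^ 2 * v ^ 2 := by positivity
    linarith

/-! ### Oscillation of Bessel functions -/

/-- Sturm comparison with `sin ((x - N) / 2)`: a nonvanishing `J_l` is impossible on a long
interval far to the right. -/
theorem exists_besselJ_zero_gt {l : ℝ} (hl : 0 < l) (M : ℝ) :
    ∃ x, M < x ∧ 0 < x ∧ besselJ l x = 0 := by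
  set N : ℝ := max M 0 + 2 * (l + 1) with hN
  have hN0 : 2 * (l + 1) ≤ N := by linarith [le_max_right M 0]
  have hNM : M < N := by linarith [le_max_left M 0]
  have hpi := Real.pi_pos
  by_contra! hne
  have hne' : ∀ x ∈ Icc N (N + 2 * Real.pi), besselJ l x ≠ 0 :=
    fun x hx => hne x (by linarith [hx.1]) (by linarith [hx.1])
  have hcont : ContinuousOn (besselJ l) (Icc N (N + 2 * Real.pi)) := fun x hx =>
    (hasDerivAt_besselJ hl (by linarith [hx.1])).continuousAt.continuousWithinAt
  obtain ⟨σ, hσ, hpos⟩ : ∃ σ : ℝ, σ ≠ 0 ∧ ∀ x ∈ Icc N (N + 2 * Real.pi), 0 < σ * besselJ l x := by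
    rcases isPreconnected_Icc.mapsTo_Ioi_or_Iio hcont hne' with h | h
    · exact ⟨1, one_ne_zero, fun x hx => by simpa using h hx⟩
    · exact ⟨-1, by norm_num, fun x hx => by simpa using h hx⟩
  -- Wronskian of `w = √x J_l` and `sin ((x - N) / 2)`, where `w'' + (1 - (l² - 1/4)/x²) w = 0`.
  -- Beyond `N` the coefficient of `w` exceeds the `1/4` of the sine.
  set Φ : ℝ → ℝ := fun x => σ * (Real.sqrt x *
    (((l + 1 / 2) / x * besselJ l x - besselJ (l + 1) x) * Real.sin ((x - N) / 2)
      - besselJ l x * (Real.cos ((x - N) / 2) / 2))) with hΦ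
  have hd : ∀ x, 0 < x → HasDerivAt Φ (Real.sqrt x * ((1 / 4 - (1 - (l ^ 2 - 1 / 4) / x ^ 2)) *
      (σ * besselJ l x) * Real.sin ((x - N) / 2))) x := by
    intro x hx
    have hu := hasDerivAt_besselJ hl hx
    have hv := hasDerivAt_besselJ_add_one hl hx
    have hlin : HasDerivAt (fun y : ℝ => (y - N) / 2) (1 / 2) x :=
      ((hasDerivAt_id x).sub_const N).div_const 2
    have h := (((Real.hasDerivAt_sqrt hx.ne').mul
      ((((((hasDerivAt_const x (l + 1 / 2)).div (hasDerivAt_id x) hx.ne').mul hu).sub hv).mul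
        hlin.sin).sub (hu.mul (hlin.cos.div_const 2))))).const_mul σ
    refine h.congr_deriv ?_
    have hr : 0 < Real.sqrt x := Real.sqrt_pos.2 hx
    have hr2 : x = Real.sqrt x ^ 2 := (Real.sq_sqrt hx.le).symm
    simp only [Pi.mul_apply, Pi.sub_apply, Pi.div_apply, id]
    generalize Real.sin ((x - N) / 2) = s
    generalize Real.cos ((x - N) / 2) = c
    generalize besselJ l x = u
    generalize besselJ (l + 1) x = v
    generalize Real.sqrt x = r at *
    subst hr2
    field_simp
    ring
  have hanti : AntitoneOn Φ (Icc N (N + 2 * Real.pi)) := by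
    refine antitoneOn_of_deriv_nonpos (convex_Icc _ _)
      (fun y hy => (hd y (by linarith [hy.1])).continuousAt.continuousWithinAt)
      (fun y hy => ?_) ?_
    · rw [interior_Icc] at hy
      exact (hd y (by linarith [hy.1])).differentiableAt.differentiableWithinAt
    · intro y hy
      rw [interior_Icc] at hy
      have hy0 : 0 < y := by linarith [hy.1]
      rw [(hd y hy0).deriv]
      have hs : 0 ≤ Real.sin ((y - N) / 2) :=
        Real.sin_nonneg_of_nonneg_of_le_pi (by linarith [hy.1]) (by linarith [hy.2])
      have hu := hpos y ⟨hy.1.le, hy.2.le⟩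
      have hq : 1 / 4 - (1 - (l ^ 2 - 1 / 4) / y ^ 2) ≤ 0 := by
        have : (l ^ 2 - 1 / 4) / y ^ 2 ≤ 1 / 4 := by
          rw [div_le_iff₀ (by positivity)]
          nlinarith [hy.1]
        linarith
      have h1 : 0 ≤ Real.sqrt y * ((σ * besselJ l y) * Real.sin ((y - N) / 2)) := by positivity
      nlinarith
  -- At the endpoints only the cosine term survives, making `Φ` negative on the left and positive on
  -- the right.
  have hle := hanti (left_mem_Icc.2 (by linarith)) (right_mem_Icc.2 (by linarith))
    (by linarith : N ≤ N + 2 * Real.pi)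
  have h1 := hpos N (left_mem_Icc.2 (by linarith))
  have h2 := hpos (N + 2 * Real.pi) (right_mem_Icc.2 (by linarith))
  have s1 : 0 < Real.sqrt N := Real.sqrt_pos.2 (by linarith)
  have s2 : 0 < Real.sqrt (N + 2 * Real.pi) := Real.sqrt_pos.2 (by linarith)
  have e : (N + 2 * Real.pi - N) / 2 = Real.pi := by ring
  simp only [hΦ, e, sub_self, zero_div, Real.sin_zero, Real.cos_zero, Real.sin_pi,
    Real.cos_pi, mul_zero, zero_sub] at hle
  nlinarith [mul_pos s1 h1, mul_pos s2 h2]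

/-! ### Ratios with negative Wronskian -/

/-- A ratio with negative Wronskian is strictly decreasing away from the poles. -/
theorem strictAntiOn_div_of_wronskian_neg {f g f' g' : ℝ → ℝ} {s : Set ℝ} (hs : Convex ℝ s)
    (hf : ∀ x ∈ s, HasDerivAt f (f' x) x) (hg : ∀ x ∈ s, HasDerivAt g (g' x) x)
    (hW : ∀ x ∈ s, f' x * g x - f x * g' x < 0) (h0 : ∀ x ∈ s, g x ≠ 0) :
    StrictAntiOn (fun x => f x / g x) s := by
  have hd : ∀ x ∈ s, HasDerivAt (fun x => f x / g x) ((f' x * g x - f x * g' x) / g x ^ 2) x :=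
    fun x hx => (hf x hx).div (hg x hx) (h0 x hx)
  refine strictAntiOn_of_deriv_neg hs (fun x hx => (hd x hx).continuousAt.continuousWithinAt) ?_
  intro x hx
  have hx := interior_subset hx
  rw [(hd x hx).deriv]
  have := h0 x hx
  exact div_neg_of_neg_of_pos (hW x hx) (by positivity)

/-- Where `g = 0` the Wronskian is `-f g'`, so `(g/f)' = g'/f > 0`: the reciprocal `g/f` crosses
zero upwards. -/
theorem tendsto_div_atTop_of_wronskian_neg {f g f' g' : ℝ → ℝ} {x : ℝ}
    (hf : HasDerivAt f (f' x) x) (hg : HasDerivAt g (g' x) x)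
    (hW : f' x * g x - f x * g' x < 0) (h0 : g x = 0) :
    Tendsto (fun x => f x / g x) (𝓝[>] x) atTop ∧
      Tendsto (fun x => f x / g x) (𝓝[<] x) atBot ∧ ∀ᶠ y in 𝓝[≠] x, g y ≠ 0 := by
  have hfx : f x ≠ 0 := by
    rintro h
    simp [h, h0] at hW
  have hgx : g' x ≠ 0 := by
    rintro h
    simp [h, h0] at hW
  have hd : HasDerivAt (fun y => g y / f y) (g' x / f x) x := by
    refine (hg.div hf hfx).congr_deriv ?_
    rw [h0]
    field_simp
    ring
  have hpos : 0 < g' x / f x := by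
    rw [h0] at hW
    rw [show g' x / f x = f x * g' x / f x ^ 2 by field_simp]
    exact div_pos (by linarith) (by positivity)
  have hval : g x / f x = 0 := by simp [h0]
  have hinv : (fun x => f x / g x) = fun x => (g x / f x)⁻¹ := by
    funext y
    rw [inv_div]
  have hlim : Tendsto (fun y => g y / f y) (𝓝 x) (𝓝 0) := by
    simpa [hval] using hd.continuousAt.tendsto
  have hsl := hasDerivAt_iff_tendsto_slope.1 hd
  have hev : ∀ᶠ y in 𝓝[≠] x, 0 < slope (fun y => g y / f y) x y :=
    hsl.eventually (lt_mem_nhds hpos)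
  refine ⟨?_, ?_, hg.eventually_ne hgx⟩
  · rw [hinv]
    refine tendsto_inv_nhdsGT_zero.comp ?_
    refine tendsto_nhdsWithin_iff.2 ⟨hlim.mono_left nhdsWithin_le_nhds, ?_⟩
    filter_upwards [hev.filter_mono (nhdsWithin_mono x fun y hy => ne_of_gt hy),
      self_mem_nhdsWithin] with y hy hxy
    rw [slope_def_field, hval, sub_zero] at hy
    exact (div_pos_iff_of_pos_right (sub_pos.2 hxy)).1 hy
  · rw [hinv]
    refine tendsto_inv_nhdsLT_zero.comp ?_
    refine tendsto_nhdsWithin_iff.2 ⟨hlim.mono_left nhdsWithin_le_nhds, ?_⟩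
    filter_upwards [hev.filter_mono (nhdsWithin_mono x fun y hy => ne_of_lt hy),
      self_mem_nhdsWithin] with y hy hxy
    rw [slope_def_field, hval, sub_zero] at hy
    have hxy : y < x := hxy
    have := mul_neg_of_pos_of_neg hy (sub_neg.2 hxy)
    rwa [div_mul_cancel₀ _ (sub_neg.2 hxy).ne] at this

/-- At a pole of the sum of two ratios with negative Wronskians there is no cancellation. -/
theorem tendsto_add_div_of_wronskian_neg {f g f' g' p q p' q' : ℝ → ℝ} {x : ℝ}
    (hf : HasDerivAt f (f' x) x) (hg : HasDerivAt g (g' x) x)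
    (hp : HasDerivAt p (p' x) x) (hq : HasDerivAt q (q' x) x)
    (hW : f' x * g x - f x * g' x < 0) (hV : p' x * q x - p x * q' x < 0)
    (h0 : g x = 0 ∨ q x = 0) :
    Tendsto (fun x => f x / g x + p x / q x) (𝓝[>] x) atTop ∧
      Tendsto (fun x => f x / g x + p x / q x) (𝓝[<] x) atBot := by
  have hc : ∀ {a b a' b' : ℝ → ℝ}, HasDerivAt a (a' x) x → HasDerivAt b (b' x) x → b x ≠ 0 →
      Tendsto (fun x => a x / b x) (𝓝 x) (𝓝 (a x / b x)) := fun ha hb h =>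
    (ha.continuousAt.div hb.continuousAt h)
  by_cases hg0 : g x = 0 <;> by_cases hq0 : q x = 0
  · obtain ⟨a, b, -⟩ := tendsto_div_atTop_of_wronskian_neg hf hg hW hg0
    obtain ⟨c, d, -⟩ := tendsto_div_atTop_of_wronskian_neg hp hq hV hq0
    exact ⟨a.atTop_add_atTop c, b.atBot_add_atBot d⟩
  · obtain ⟨a, b, -⟩ := tendsto_div_atTop_of_wronskian_neg hf hg hW hg0
    have c := hc hp hq hq0
    exact ⟨a.atTop_add (c.mono_left nhdsWithin_le_nhds),
      b.atBot_add (c.mono_left nhdsWithin_le_nhds)⟩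
  · obtain ⟨a, b, -⟩ := tendsto_div_atTop_of_wronskian_neg hp hq hV hq0
    have c := hc hf hg hg0
    exact ⟨(c.mono_left nhdsWithin_le_nhds).add_atTop a,
      (c.mono_left nhdsWithin_le_nhds).add_atBot b⟩
  · tauto

/-! ### Enumeration and interlacing -/

/-- A set of reals that is unbounded above and finite below every bound has an ascending
enumeration. -/
theorem exists_isAscendingEnum {S : Set ℝ} (hfin : ∀ M, (S ∩ Iic M).Finite)
    (hunb : ∀ M, ∃ x ∈ S, M < x) :
    ∃ ω : ℕ → ℝ, IsAscendingEnum ω S := by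
  have hstep : ∀ M, ∃ x ∈ S, M < x ∧ ∀ y ∈ S, M < y → x ≤ y := by
    intro M
    obtain ⟨z, hz, hMz⟩ := hunb M
    have hf : ((S ∩ Iic z) ∩ Ioi M).Finite := (hfin z).inter_of_left _
    obtain ⟨x, hx, hmin⟩ := hf.exists_minimal ⟨z, ⟨hz, self_mem_Iic⟩, hMz⟩
    refine ⟨x, hx.1.1, hx.2, fun y hy hMy => ?_⟩
    rcases le_total x y with h | h
    · exact h
    · exact hmin ⟨⟨hy, h.trans hx.1.2⟩, hMy⟩ h
  choose nx hnS hlt hmin using hstep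
  obtain ⟨s₀, hs₀, hs₀min⟩ : ∃ x ∈ S, ∀ y ∈ S, x ≤ y := by
    obtain ⟨z, hz, -⟩ := hunb 0
    obtain ⟨x, hx, hmin⟩ := (hfin z).exists_minimal ⟨z, hz, self_mem_Iic⟩
    refine ⟨x, hx.1, fun y hy => ?_⟩
    rcases le_total x y with h | h
    · exact h
    · exact hmin ⟨hy, h.trans hx.2⟩ h
  set ω : ℕ → ℝ := fun n => nx^[n] s₀ with hω
  have hsucc : ∀ n, ω (n + 1) = nx (ω n) := fun n => Function.iterate_succ_apply' _ _ _
  have hmem : ∀ n, ω n ∈ S := by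
    rintro (_ | n)
    · exact hs₀
    · rw [hsucc]
      exact hnS _
  have hmono : StrictMono ω := strictMono_nat_of_lt_succ fun n => by
    rw [hsucc]
    exact hlt _
  refine ⟨ω, hmono, Subset.antisymm (range_subset_iff.2 hmem) fun y hy => ?_⟩
  by_contra hny
  have hall : ∀ n, ω n ≤ y := by
    intro n
    induction n with
    | zero => exact hs₀min y hy
    | succ n ih =>
      rw [hsucc]
      exact hmin _ y hy (lt_of_le_of_ne ih fun h => hny ⟨n, h⟩)
  exact Set.infinite_range_of_injective hmono.injective
    ((hfin y).subset (range_subset_iff.2 fun n => ⟨hmem n, hall n⟩))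

/-- A set of positive reals which is bounded away from zero and has no accumulation point among the
positive reals is finite below every bound. -/
theorem finite_inter_Iic_of_isolated {S : Set ℝ} {ε : ℝ} (hε : 0 < ε) (hS : ∀ x ∈ S, ε ≤ x)
    (hiso : ∀ x, 0 < x → ∀ᶠ y in 𝓝[≠] x, y ∉ S) (M : ℝ) : (S ∩ Iic M).Finite := by
  by_contra hinf
  obtain ⟨x, hx, hacc⟩ := Set.Infinite.exists_accPt_of_subset_isCompact (K := Icc ε M) hinf
    isCompact_Icc fun y hy => ⟨hS y hy.1, hy.2⟩
  rw [accPt_iff_frequently_nhdsNE] at hacc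
  exact hacc ((hiso x (hε.trans_le hx.1)).mono fun y hy h => hy h.1)

/-- Interlacing of the zeros and the poles of a decreasing function on the positive half-line. -/
theorem exists_interlacing_zeros {F : ℝ → ℝ} {S : Set ℝ} {ω : ℕ → ℝ} (hω : IsAscendingEnum ω S)
    (hpos : ∀ x ∈ S, 0 < x) (hlim : Tendsto ω atTop atTop)
    (hcont : ∀ x, 0 < x → x ∉ S → ContinuousAt F x)
    (hanti : ∀ a b, 0 ≤ a → Disjoint (Ioo a b) S → StrictAntiOn F (Ioo a b))
    (htop : ∀ x ∈ S, Tendsto F (𝓝[>] x) atTop) (hbot : ∀ x ∈ S, Tendsto F (𝓝[<] x) atBot)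
    (hzero : ∀ᶠ x in 𝓝[>] (0 : ℝ), 0 < F x) :
    ∃ a : ℕ → ℝ, IsAscendingEnum a {x | 0 < x ∧ x ∉ S ∧ F x = 0} ∧ 0 < a 0 ∧
      ∀ k, a k < ω k ∧ ω k < a (k + 1) := by
  obtain ⟨hmono, hrange⟩ := hω
  have hmem : ∀ n, ω n ∈ S := fun n => hrange ▸ mem_range_self n
  -- Prepending `0` to `ω` makes `(b n, ω n)` the `n`-th pole-free gap.
  set b : ℕ → ℝ := fun n => Nat.casesOn n 0 ω with hb
  have hb0 : ∀ n, 0 ≤ b n := by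
    rintro (_ | n)
    · exact le_rfl
    · exact (hpos _ (hmem n)).le
  have hbω : ∀ n, b n < ω n := by
    rintro (_ | n)
    · exact hpos _ (hmem 0)
    · exact hmono n.lt_succ_self
  have hdisj : ∀ n, Disjoint (Ioo (b n) (ω n)) S := by
    intro n
    rw [Set.disjoint_left, ← hrange]
    rintro _ hx ⟨k, rfl⟩
    have h2 := hmono.lt_iff_lt.1 hx.2
    rcases n with _ | n
    · omega
    · have h1 : n < k := hmono.lt_iff_lt.1 hx.1
      omega
  have hbF : ∀ n, ∀ᶠ x in 𝓝[>] (b n), 0 < F x := by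
    rintro (_ | n)
    · exact hzero
    · exact (htop _ (hmem n)).eventually_gt_atTop 0
  have hex : ∀ n, ∃ x ∈ Ioo (b n) (ω n), F x = 0 := by
    intro n
    obtain ⟨y, hy, hyI⟩ := ((hbF n).and (Ioo_mem_nhdsGT (hbω n))).exists
    obtain ⟨z, hz, hzI⟩ := (((hbot _ (hmem n)).eventually_lt_atBot 0).and
      (Ioo_mem_nhdsLT (hbω n))).exists
    have hc : ContinuousOn F (Ioo (b n) (ω n)) := fun x hx =>
      (hcont x ((hb0 n).trans_lt hx.1)
        (Set.disjoint_left.1 (hdisj n) hx)).continuousWithinAt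
    exact isPreconnected_Ioo.intermediate_value hzI hyI hc ⟨hz.le, hy.le⟩
  choose a haI haF using hex
  have hlt : ∀ k, ω k < a (k + 1) := fun k => (haI (k + 1)).1
  refine ⟨a, ⟨strictMono_nat_of_lt_succ fun n => (haI n).2.trans (hlt n), ?_⟩,
    (haI 0).1, fun k => ⟨(haI k).2, hlt k⟩⟩
  refine Subset.antisymm (range_subset_iff.2 fun n => ⟨(hb0 n).trans_lt (haI n).1,
    Set.disjoint_left.1 (hdisj n) (haI n), haF n⟩) ?_
  rintro x ⟨hx0, hxS, hxF⟩
  have hexn : ∃ n, x < ω n := (hlim.eventually_gt_atTop x).exists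
  classical
  set n := Nat.find hexn with hn
  have hxn : x < ω n := Nat.find_spec hexn
  have hbx : b n < x := by
    rcases hk : n with _ | k
    · exact hx0
    · have : ¬ x < ω k := Nat.find_min hexn (by omega)
      exact lt_of_le_of_ne (not_lt.1 this) fun h => hxS (h ▸ hmem k)
  exact ⟨n, (hanti _ _ (hb0 n) (hdisj n)).injOn (haI n) ⟨hbx, hxn⟩ ((haF n).trans hxF.symm)⟩

/-! ### Lommel polynomials and `R*` -/

/-- The coefficients of the Lommel polynomial, up to sign. -/
noncomputable def lommelCoeff (n : ℕ) (ν : ℝ) (k : ℕ) : ℝ :=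
  ((n - k).choose k : ℝ) * (ascPochhammer ℝ (n - 2 * k)).eval (ν + k)

theorem lommelCoeff_eq_zero {n k : ℕ} (h : n < 2 * k) (ν : ℝ) : lommelCoeff n ν k = 0 := by
  rw [lommelCoeff, Nat.choose_eq_zero_of_lt (by omega)]
  simp

/-- Padding with zero terms lets sums of different degrees be compared over matching ranges. -/
theorem lommelNat_eq_sum {n N : ℕ} (hN : n / 2 + 1 ≤ N) (ν x : ℝ) :
    lommelNat n ν x = ∑ k ∈ Finset.range N,
      (-1 : ℝ) ^ k * lommelCoeff n ν k * (x / 2) ^ (2 * (k : ℤ) - (n : ℤ)) := by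
  rw [lommelNat]
  refine Finset.sum_subset_zero_on_sdiff (Finset.range_mono hN) (fun k hk => ?_) fun k _ => ?_
  · rw [Finset.mem_sdiff, Finset.mem_range, Finset.mem_range] at hk
    rw [lommelCoeff_eq_zero (by omega)]
    simp
  · rw [lommelCoeff]
    ring

theorem ascPochhammer_succ_left_eval (n : ℕ) (s : ℝ) :
    (ascPochhammer ℝ (n + 1)).eval s = s * (ascPochhammer ℝ n).eval (s + 1) := by
  simp [ascPochhammer_succ_left]

theorem lommelCoeff_zero_recurrence (n : ℕ) (ν : ℝ) :
    lommelCoeff (n + 1) ν 0 = (ν + n) * lommelCoeff n ν 0 := by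
  simp only [lommelCoeff, Nat.sub_zero, Nat.choose_zero_right, mul_zero, ascPochhammer_succ_eval]
  push_cast
  ring

theorem lommelCoeff_recurrence (n : ℕ) (ν : ℝ) (k : ℕ) :
    lommelCoeff (n + 2) ν (k + 1)
      = (ν + n + 1) * lommelCoeff (n + 1) ν (k + 1) + lommelCoeff n ν k := by
  rcases lt_trichotomy n (2 * k) with h | h | h
  · rw [lommelCoeff_eq_zero (by omega), lommelCoeff_eq_zero (by omega),
      lommelCoeff_eq_zero (by omega)]
    simp
  · rw [lommelCoeff_eq_zero (n := n + 1) (by omega), lommelCoeff, lommelCoeff,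
      show n + 2 - (k + 1) = k + 1 by omega, show n + 2 - 2 * (k + 1) = 0 by omega,
      show n - k = k by omega, show n - 2 * k = 0 by omega]
    simp
  · obtain ⟨j, rfl⟩ : ∃ j, n = 2 * k + 1 + j := ⟨n - (2 * k + 1), by omega⟩
    rw [lommelCoeff, lommelCoeff, lommelCoeff,
      show 2 * k + 1 + j + 2 - (k + 1) = (k + 1 + j) + 1 by omega,
      show 2 * k + 1 + j + 2 - 2 * (k + 1) = j + 1 by omega,
      show 2 * k + 1 + j + 1 - (k + 1) = k + 1 + j by omega,
      show 2 * k + 1 + j + 1 - 2 * (k + 1) = j by omega,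
      show 2 * k + 1 + j - k = k + 1 + j by omega,
      show 2 * k + 1 + j - 2 * k = j + 1 by omega,
      ascPochhammer_succ_left_eval j (ν + k), ascPochhammer_succ_eval, Nat.choose_succ_succ']
    -- After Pascal's rule and removal of the common Pochhammer factor, this binomial identity is
    -- all that remains.
    have hc : ((k + 1 + j).choose (k + 1) : ℝ) * (k + 1) = (k + 1 + j).choose k * (j + 1) := by
      have := Nat.choose_succ_right_eq (k + 1 + j) k
      rw [show k + 1 + j - k = j + 1 by omega] at this
      exact_mod_cast this
    push_cast
    rw [show ν + (k + 1 : ℝ) = ν + k + 1 by ring]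
    generalize Polynomial.eval (ν + k + 1) (ascPochhammer ℝ j) = P
    linear_combination (-P) * hc

theorem lommelNat_recurrence (n : ℕ) (ν : ℝ) {x : ℝ} (hx : x ≠ 0) :
    lommelNat (n + 2) ν x
      = 2 * (ν + n + 1) / x * lommelNat (n + 1) ν x - lommelNat n ν x := by
  have hy : x / 2 ≠ 0 := by simpa using hx
  rw [lommelNat_eq_sum (N := n + 1 + 1) (n := n + 2) (by omega),
    lommelNat_eq_sum (N := n + 1 + 1) (n := n + 1) (by omega),
    lommelNat_eq_sum (N := n + 1) (n := n) (by omega), show 2 * (ν + n + 1) / x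
      = (ν + n + 1) * (x / 2)⁻¹ by field_simp,
    Finset.sum_range_succ', Finset.sum_range_succ' _ (n + 1), mul_add, Finset.mul_sum,
    add_sub_right_comm, ← Finset.sum_sub_distrib]
  generalize x / 2 = y at *
  congr 1
  · refine Finset.sum_congr rfl fun k _ => ?_
    have e1 : y ^ (2 * ((k + 1 : ℕ) : ℤ) - ((n + 1 : ℕ) : ℤ)) = y ^ (2 * (k : ℤ) - n) * y := by
      rw [← zpow_add_one₀ hy]
      congr 1
      push_cast
      ring
    have e2 : y ^ (2 * ((k + 1 : ℕ) : ℤ) - ((n + 2 : ℕ) : ℤ)) = y ^ (2 * (k : ℤ) - n) := by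
      congr 1
      push_cast
      ring
    rw [e1, e2, lommelCoeff_recurrence, pow_succ]
    field_simp
    ring
  · have e1 : y ^ (2 * ((0 : ℕ) : ℤ) - ((n + 1 : ℕ) : ℤ))
        = y ^ (2 * ((0 : ℕ) : ℤ) - ((n + 2 : ℕ) : ℤ)) * y := by
      rw [← zpow_add_one₀ hy]
      congr 1
    rw [e1, show n + 2 = n + 1 + 1 by ring, lommelCoeff_zero_recurrence (n + 1)]
    push_cast
    field_simp
    ring

theorem lommelNat_zero (ν x : ℝ) : lommelNat 0 ν x = 1 := by
  simp [lommelNat]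

theorem lommelNat_one (ν x : ℝ) : lommelNat 1 ν x = 2 * ν / x := by
  simp [lommelNat]
  ring

theorem lommelRStar_zero (ν x : ℝ) : lommelRStar (0 : ℕ) ν x = 1 := by
  -- The negative-index convention gives `R_{-2,ν+2} = -R_{0,ν+1} = -1`.
  change (lommelNat 0 ν x - -lommelNat 0 (ν + 2 - (0 : ℕ) - 1) x) / 2 = 1
  rw [lommelNat_zero, lommelNat_zero]
  norm_num

theorem lommelRStar_one (ν x : ℝ) : lommelRStar (1 : ℕ) ν x = ν / x := by
  change (lommelNat 1 ν x - 0) / 2 = ν / x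
  rw [lommelNat_one]
  ring

theorem lommelRStar_add_two (m : ℕ) (ν x : ℝ) :
    lommelRStar (m + 2 : ℕ) ν x = (lommelNat (m + 2) ν x - lommelNat m (ν + 2) x) / 2 := by
  rw [lommelRStar, show ((m + 2 : ℕ) : ℤ) - 2 = (m : ℕ) by push_cast; ring]
  rfl

/-- `R_{m,ν}` and `R_{m-2,ν+2}` obey the same recurrence, since `ν + m` is unchanged by the shift.
The first two cases involve negative indices and are computed directly. -/
theorem lommelRStar_recurrence (m : ℕ) (ν : ℝ) {x : ℝ} (hx : x ≠ 0) :
    lommelRStar (m + 2 : ℕ) ν x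
      = 2 * (ν + m + 1) / x * lommelRStar (m + 1 : ℕ) ν x - lommelRStar (m : ℕ) ν x := by
  rw [lommelRStar_add_two, lommelNat_recurrence m ν hx]
  rcases m with _ | _ | m
  · rw [lommelRStar_zero, zero_add, lommelRStar_one, lommelNat_zero, lommelNat_zero,
      lommelNat_one]
    push_cast
    ring
  · rw [lommelRStar_add_two 0, lommelNat_zero, zero_add, lommelRStar_one, lommelNat_one,
      lommelNat_one]
    push_cast
    ring
  · rw [lommelNat_recurrence m (ν + 2) hx, show m + 1 + 1 + 1 = (m + 1) + 2 by ring,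
      lommelRStar_add_two (m + 1), lommelRStar_add_two m]
    push_cast
    ring

/-- The recurrence gives `W_{m+1} = W_m - (2(ν+m+1)/x²) (R*_{m+1})²`, starting from `W_0 = -ν/x²`.
-/
theorem lommelRStar_wronskian_neg {ν : ℝ} (hν : 0 < ν) (m : ℕ) {x : ℝ} (hx : 0 < x) :
    DifferentiableAt ℝ (lommelRStar (m : ℕ) ν) x ∧
      DifferentiableAt ℝ (lommelRStar (m + 1 : ℕ) ν) x ∧
      deriv (lommelRStar (m + 1 : ℕ) ν) x * lommelRStar (m : ℕ) ν x
        - lommelRStar (m + 1 : ℕ) ν x * deriv (lommelRStar (m : ℕ) ν) x < 0 := by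
  induction m with
  | zero =>
    have h0 : lommelRStar (0 : ℕ) ν = fun _ => 1 := funext (lommelRStar_zero ν)
    have h1 : lommelRStar (0 + 1 : ℕ) ν = fun x => ν / x := funext (lommelRStar_one ν)
    have hd : HasDerivAt (fun x => ν / x) (-ν / x ^ 2) x := by
      refine ((hasDerivAt_const x ν).div (hasDerivAt_id x) hx.ne').congr_deriv ?_
      simp
    rw [h0, h1]
    refine ⟨differentiableAt_const _, hd.differentiableAt, ?_⟩
    rw [hd.deriv, deriv_const, mul_one, mul_zero, sub_zero, neg_div]
    have : 0 < ν / x ^ 2 := by positivity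
    linarith
  | succ m ih =>
    obtain ⟨d0, d1, hW⟩ := ih
    have hq : HasDerivAt (fun y => 2 * (ν + m + 1) / y) (-(2 * (ν + m + 1)) / x ^ 2) x := by
      refine ((hasDerivAt_const x _).div (hasDerivAt_id x) hx.ne').congr_deriv ?_
      simp
    have hd := ((hq.mul d1.hasDerivAt).sub d0.hasDerivAt).congr_of_eventuallyEq
      (f₁ := lommelRStar (m + 2 : ℕ) ν) (by
        filter_upwards [lt_mem_nhds hx] with y hy
        exact lommelRStar_recurrence m ν hy.ne')
    refine ⟨d1, hd.differentiableAt, ?_⟩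
    change deriv (lommelRStar (m + 2 : ℕ) ν) x * _ - lommelRStar (m + 2 : ℕ) ν x * _ < 0
    rw [hd.deriv, lommelRStar_recurrence m ν hx.ne']
    have : 0 ≤ 2 * (ν + m + 1) / x ^ 2 * lommelRStar (m + 1 : ℕ) ν x ^ 2 := by positivity
    have e : -(2 * (ν + m + 1)) / x ^ 2 = -(2 * (ν + m + 1) / x ^ 2) := neg_div _ _
    rw [e]
    nlinarith

/-- For `x ≤ ν` the recurrence factor is at least `2`, so the increments in `m` stay nonnegative. -/
theorem lommelRStar_pos_of_le {ν : ℝ} (m : ℕ) {x : ℝ} (hx : 0 < x) (hxν : x ≤ ν) :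
    0 < lommelRStar (m : ℕ) ν x ∧ lommelRStar (m : ℕ) ν x ≤ lommelRStar (m + 1 : ℕ) ν x := by
  induction m with
  | zero =>
    rw [lommelRStar_zero, zero_add, lommelRStar_one]
    exact ⟨one_pos, (one_le_div hx).2 hxν⟩
  | succ m ih =>
    refine ⟨ih.1.trans_le ih.2, ?_⟩
    change _ ≤ lommelRStar (m + 2 : ℕ) ν x
    rw [lommelRStar_recurrence m ν hx.ne']
    have : 2 ≤ 2 * (ν + m + 1) / x := by
      rw [le_div_iff₀ hx]
      have : (0 : ℝ) ≤ m := m.cast_nonneg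
      nlinarith
    nlinarith [ih.1, ih.2]

/-! ### The decomposition of `J_ν'` and the interlacing theorem -/

/-- `J_ν' = R*_{m+1,ν} J_{ν+m} - R*_{m,ν} J_{ν+m+1}`. -/
theorem deriv_besselJ_eq {ν : ℝ} (hν : 0 < ν) (m : ℕ) {x : ℝ} (hx : 0 < x) :
    deriv (besselJ ν) x = lommelRStar (m + 1 : ℕ) ν x * besselJ (ν + m) x
      - lommelRStar (m : ℕ) ν x * besselJ (ν + m + 1) x := by
  induction m with
  | zero =>
    rw [(hasDerivAt_besselJ hν hx).deriv, zero_add, lommelRStar_one, lommelRStar_zero]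
    simp
  | succ m ih =>
    rw [ih]
    change _ = lommelRStar (m + 2 : ℕ) ν x * _ - _
    rw [lommelRStar_recurrence m ν hx.ne']
    have h := besselJ_recurrence (l := ν + m) (by positivity) hx
    have e1 : ν + ((m + 1 : ℕ) : ℝ) = ν + m + 1 := by push_cast; ring
    have e2 : ν + m + 1 + 1 = ν + m + 2 := by ring
    rw [e1, e2, h]
    ring

theorem theorem5p1 (ν : ℝ) (hν : 0 < ν) (m : ℕ) :
    ∃ a ω : ℕ → ℝ,
      IsAscendingEnum a
        (posZeros (deriv (besselJ ν)) \
          {x | x ∈ posZeros (deriv (besselJ ν)) ∧ besselJ (ν + m) x = 0}) ∧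
      IsAscendingEnum ω (posZeros (besselJ (ν + m)) ∪ posZeros (lommelRStar m ν)) ∧
      0 < a 0 ∧ ∀ k : ℕ, a k < ω k ∧ ω k < a (k + 1) := by
  set l : ℝ := ν + m with hl_def
  have hl : 0 < l := by positivity
  set S : Set ℝ := posZeros (besselJ l) ∪ posZeros (lommelRStar m ν) with hS
  set f : ℝ → ℝ := lommelRStar (m + 1 : ℕ) ν
  set g : ℝ → ℝ := lommelRStar m ν
  -- The sign is put into `p` so that both ratios have negative Wronskian.
  set p : ℝ → ℝ := fun x => -besselJ (l + 1) x
  set q : ℝ → ℝ := besselJ l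
  set p' : ℝ → ℝ := fun x => -(besselJ l x - (l + 1) / x * besselJ (l + 1) x)
  set q' : ℝ → ℝ := fun x => l / x * besselJ l x - besselJ (l + 1) x
  set F : ℝ → ℝ := fun x => f x / g x + p x / q x with hF
  have hf : ∀ x, 0 < x → HasDerivAt f (deriv f x) x := fun x hx =>
    (lommelRStar_wronskian_neg hν m hx).2.1.hasDerivAt
  have hg : ∀ x, 0 < x → HasDerivAt g (deriv g x) x := fun x hx =>
    (lommelRStar_wronskian_neg hν m hx).1.hasDerivAt
  have hW : ∀ x, 0 < x → deriv f x * g x - f x * deriv g x < 0 := fun x hx =>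
    (lommelRStar_wronskian_neg hν m hx).2.2
  have hp : ∀ x, 0 < x → HasDerivAt p (p' x) x := fun x hx =>
    (hasDerivAt_besselJ_add_one hl hx).neg
  have hq : ∀ x, 0 < x → HasDerivAt q (q' x) x := fun x hx => hasDerivAt_besselJ hl hx
  have hV : ∀ x, 0 < x → p' x * q x - p x * q' x < 0 := by
    intro x hx
    have := besselJ_wronskian_pos hl hx
    simp only [p', q', p, q]
    linarith
  have hmemS : ∀ x, 0 < x → (x ∈ S ↔ g x = 0 ∨ q x = 0) := by
    intro x hx
    simp only [hS, posZeros, mem_union, mem_ofPred_eq, hx, true_and]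
    exact or_comm
  have hSpos : ∀ x ∈ S, 0 < x := by
    rintro x (h | h) <;> exact h.1
  have hnotS : ∀ x, 0 < x → x ∉ S → g x ≠ 0 ∧ q x ≠ 0 := fun x hx h =>
    not_or.1 (mt (hmemS x hx).2 h)
  have hiso : ∀ x, 0 < x → ∀ᶠ y in 𝓝[≠] x, y ∉ S := by
    intro x hx
    have key : ∀ {u v u' v' : ℝ → ℝ}, HasDerivAt u (u' x) x → HasDerivAt v (v' x) x →
        u' x * v x - u x * v' x < 0 → ∀ᶠ y in 𝓝[≠] x, v y ≠ 0 := by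
      intro u v u' v' hu hv h
      by_cases h0 : v x = 0
      · exact (tendsto_div_atTop_of_wronskian_neg hu hv h h0).2.2
      · exact (hv.continuousAt.eventually_ne h0).filter_mono nhdsWithin_le_nhds
    filter_upwards [key (hf x hx) (hg x hx) (hW x hx), key (hp x hx) (hq x hx) (hV x hx)]
      with y hy1 hy2 hyS
    exact ((hmemS y (hSpos y hyS)).1 hyS).elim hy1 hy2
  have hnear : ∀ᶠ x in 𝓝[>] (0 : ℝ), x ∉ S ∧ 0 < F x := by
    filter_upwards [eventually_besselJ_pos hl, eventually_besselJ_add_one_lt hl,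
      Ioo_mem_nhdsGT hν] with x h1 h2 h3
    obtain ⟨h4, h5⟩ := lommelRStar_pos_of_le m h3.1 h3.2.le
    refine ⟨fun hxS => ((hmemS x h3.1).1 hxS).elim h4.ne' h1.ne', ?_⟩
    -- On `(0, ν)` the first ratio is at least `1`; near `0` the second exceeds `-1`.
    have h6 : 1 ≤ f x / g x := (one_le_div h4).2 h5
    have h7 : -1 < p x / q x := by
      rw [lt_div_iff₀ h1]
      simp only [p]
      linarith
    simp only [hF]
    linarith
  obtain ⟨ε, hε, hεS⟩ := mem_nhdsGT_iff_exists_Ioo_subset.1 hnear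
  have hε : 0 < ε := hε
  have hfin : ∀ M, (S ∩ Iic M).Finite := finite_inter_Iic_of_isolated hε (fun x hx => by
    by_contra! h
    exact (hεS ⟨hSpos x hx, h⟩).1 hx) hiso
  obtain ⟨ω, hω⟩ := exists_isAscendingEnum hfin fun M => by
    obtain ⟨x, hx, hx0, h⟩ := exists_besselJ_zero_gt hl M
    exact ⟨x, Or.inl ⟨hx0, h⟩, hx⟩
  have hlim : Tendsto ω atTop atTop := by
    refine tendsto_atTop_atTop_of_monotone hω.1.monotone fun M => ?_
    obtain ⟨x, hx, hx0, h⟩ := exists_besselJ_zero_gt hl M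
    obtain ⟨n, rfl⟩ : x ∈ range ω := hω.2 ▸ Or.inl ⟨hx0, h⟩
    exact ⟨n, hx.le⟩
  have hpole := fun x (hx : x ∈ S) =>
    have h0 := hSpos x hx
    tendsto_add_div_of_wronskian_neg (hf x h0) (hg x h0) (hp x h0) (hq x h0) (hW x h0) (hV x h0)
      ((hmemS x h0).1 hx)
  obtain ⟨a, ha, ha0, hinter⟩ := exists_interlacing_zeros (F := F) hω hSpos hlim
    (fun x hx hxS => ((hf x hx).continuousAt.div (hg x hx).continuousAt (hnotS x hx hxS).1).add
      ((hp x hx).continuousAt.div (hq x hx).continuousAt (hnotS x hx hxS).2))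
    (fun a b h0 hab => by
      have hpos : ∀ x ∈ Ioo a b, 0 < x := fun x hx => h0.trans_lt hx.1
      have hne := fun x hx => hnotS x (hpos x hx) (Set.disjoint_left.1 hab hx)
      exact (strictAntiOn_div_of_wronskian_neg (convex_Ioo a b) (fun x hx => hf x (hpos x hx))
        (fun x hx => hg x (hpos x hx)) (fun x hx => hW x (hpos x hx)) fun x hx => (hne x hx).1).add
        (strictAntiOn_div_of_wronskian_neg (convex_Ioo a b) (fun x hx => hp x (hpos x hx))
        (fun x hx => hq x (hpos x hx)) (fun x hx => hV x (hpos x hx)) fun x hx => (hne x hx).2))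
    (fun x hx => (hpole x hx).1) (fun x hx => (hpole x hx).2) (hnear.mono fun x hx => hx.2)
  refine ⟨a, ω, ?_, hω, ha0, hinter⟩
  convert ha using 1
  ext x
  simp only [posZeros, Set.mem_sdiff, mem_ofPred_eq]
  have hJ : ∀ h : 0 < x, deriv (besselJ ν) x = f x * q x + g x * p x := by
    intro h
    rw [deriv_besselJ_eq hν m h]
    simp only [f, q, g, p, hl_def]
    ring
  have hFx : x ∉ S → 0 < x → F x = deriv (besselJ ν) x / (g x * q x) := by
    intro h hx
    obtain ⟨h1, h2⟩ := hnotS x hx h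
    rw [hJ hx]
    simp only [hF]
    field_simp
  constructor
  · rintro ⟨⟨hx, h0⟩, h1⟩
    have hqx : q x ≠ 0 := fun h => h1 ⟨⟨hx, h0⟩, h⟩
    -- If `g x = 0`, then `J_ν' = f q` at `x`, so `f x = 0` as well, which would make the Wronskian
    -- of `f` and `g` vanish.
    have hgx : g x ≠ 0 := by
      intro h
      have hfx : f x = 0 := by
        have := hJ hx
        rw [h0, h, zero_mul, add_zero] at this
        exact (mul_eq_zero.1 this.symm).resolve_right hqx
      have := hW x hx
      rw [h, hfx] at this
      simp at this
    have hxS : x ∉ S := fun h => ((hmemS x hx).1 h).elim hgx hqx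
    exact ⟨hx, hxS, by rw [hFx hxS hx, h0, zero_div]⟩
  · rintro ⟨hx, hxS, h⟩
    obtain ⟨h1, h2⟩ := hnotS x hx hxS
    rw [hFx hxS hx, div_eq_zero_iff] at h
    exact ⟨⟨hx, h.resolve_right (mul_ne_zero h1 h2)⟩, fun h' => h2 h'.2⟩
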